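/- Let $Z_1,\dots,Z_{d'}$ be independent standard Brownian motions on $[0,1]$ on a probability space $(\Omega,\mathcal F,P)$. Put $\Delta_n=2^{-n}$, $t_k^n=k2^{-n}$, $D_n=\{t_0^n,\dots,t_{2^n}^n\}$ and $$\Lambda_i^n(t_r^n)=Z_i(t_r^n)-Z_i(t_{r-1}^n)\quad(1\le r\le 2^n),\qquad L_{i,j}^n(k)=\sum_{r=1}^k\Lambda_i^n(t_{2r-1}^n)\Lambda_j^n(t_{2r}^n)\quad(0\le k\le 2^{n-1},\ n\ge1).$$ Let $\mathcal F_n$ be the $\sigma$-algebra generated by the increments $Z_i(t)-Z_i(s)$ with $s,t\in D_m$, $m\le n$, $1\le i\le d'$, and let $P_n(\cdot)=P(\cdot\mid\mathcal F_n)$. Fix $$\alpha\in(1/3,1/2),\quad \beta\in(1-\alpha,2\alpha),\quad \alpha'\in(\alpha,1/2),\quad \gamma\in(0,1/4],\quad \varepsilon_0\in(0,1/2),$$ indices $i\neq j$, integers $n\ge0$ and $m\ge1$, and integers $0\le k<k'\le 2^{n+m-1}$. Then, almost surely on the ($\mathcal F_n$-measurable) event that $$\max_{1\le r\le 2^n}\max\{|\Lambda_i^n(t_r^n)|,|\Lambda_j^n(t_r^n)|\}\le\Delta_n^{\alpha'}$$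 and $$\Bigl|\sum_{r=l+1}^{q}\Lambda_i^n(t_r^n)\Lambda_j^n(t_r^n)\Bigr|\le\varepsilon_0(q-l)^\beta\Delta_n^{2\alpha'}\quad\text{for all }0\le l<q\le2^n,$$ we have $$P_n\Bigl(\bigl|L_{i,j}^{n+m}(k')-L_{i,j}^{n+m}(k)\bigr|>(k'-k)^\beta\Delta_{n+m}^{2\alpha}\Bigr)\le 8\exp\Bigl(-\tfrac12\gamma\,(k'-k)^{\beta-1/2}\,\Delta_n^{2(\alpha-\alpha')}\,\Delta_m^{2\alpha-1}\Bigr).$$ -/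

import Mathlib

open MeasureTheory ProbabilityTheory

/-- `B` is a standard real Brownian motion on the time interval `[0, 1]` under `P`. -/
structure IsUnitBrownian {Ω : Type*} [MeasurableSpace Ω]
    (B : Set.Icc (0 : ℝ) 1 → Ω → ℝ) (P : Measure Ω) : Prop where
  measurable : ∀ t, Measurable (B t)
  start_zero : ∀ᵐ ω ∂P, B 0 ω = 0
  indep_increments : HasIndepIncrements B P
  gaussian_increments : ∀ s t : Set.Icc (0 : ℝ) 1, s ≤ t →
    HasLaw (fun ω => B t ω - B s ω) (gaussianReal 0 (Real.toNNReal ((t : ℝ) - (s : ℝ)))) P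
  continuous_paths : ∀ᵐ ω ∂P, Continuous (fun t => B t ω)

/-- `Z 0, …, Z (d - 1)` are independent standard Brownian motions on `[0, 1]`
(independence is that of the whole paths). -/
structure IsUnitBrownianFamily {Ω : Type*} [MeasurableSpace Ω] {d : ℕ}
    (Z : Fin d → Set.Icc (0 : ℝ) 1 → Ω → ℝ) (P : Measure Ω) : Prop where
  brownian : ∀ i, IsUnitBrownian (Z i) P
  indep : iIndepFun (fun (i : Fin d) (ω : Ω) (t : Set.Icc (0 : ℝ) 1) => Z i t ω) P

/-- The mesh `Δ_n = 2^{-n}`. -/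
noncomputable def mesh (n : ℕ) : ℝ := 1 / 2 ^ n

/-- The dyadic point `t_k^n = k / 2^n` of `[0, 1]`; it is only used for `k ≤ 2^n`, where the
projection onto `[0, 1]` does nothing. -/
noncomputable def dyadicPoint (n k : ℕ) : Set.Icc (0 : ℝ) 1 :=
  Set.projIcc 0 1 zero_le_one ((k : ℝ) / 2 ^ n)

/-- The increment `Λ_i^n(t_r^n) = Z_i(t_r^n) - Z_i(t_{r-1}^n)`, for `1 ≤ r ≤ 2^n`. -/
noncomputable def dyadicIncr {Ω : Type*} {d : ℕ} (Z : Fin d → Set.Icc (0 : ℝ) 1 → Ω → ℝ)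
    (i : Fin d) (n r : ℕ) (ω : Ω) : ℝ :=
  Z i (dyadicPoint n r) ω - Z i (dyadicPoint n (r - 1)) ω

/-- The random walk `L_{i,j}^n(k) = ∑_{r=1}^k Λ_i^n(t_{2r-1}^n) Λ_j^n(t_{2r}^n)`,
for `0 ≤ k ≤ 2^{n-1}`. -/
noncomputable def areaWalk {Ω : Type*} {d : ℕ} (Z : Fin d → Set.Icc (0 : ℝ) 1 → Ω → ℝ)
    (i j : Fin d) (n k : ℕ) (ω : Ω) : ℝ :=
  ∑ r ∈ Finset.Icc 1 k, dyadicIncr Z i n (2 * r - 1) ω * dyadicIncr Z j n (2 * r) ω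

/-- The σ-algebra `F_n` generated by the increments `Z_i(t) - Z_i(s)` of all the coordinates,
with `s, t` in the dyadic grid of order `m`, for all `m ≤ n`. -/
@[reducible] noncomputable def dyadicSigma {Ω : Type*} {d : ℕ} (Z : Fin d → Set.Icc (0 : ℝ) 1 → Ω → ℝ) (n : ℕ) :
    MeasurableSpace Ω :=
  ⨆ (m : ℕ) (_ : m ≤ n) (i : Fin d) (k : ℕ) (_ : k ≤ 2 ^ m) (l : ℕ) (_ : l ≤ 2 ^ m),
    MeasurableSpace.comap
      (fun ω => Z i (dyadicPoint m l) ω - Z i (dyadicPoint m k) ω) inferInstance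

/-- The increments of the coordinates `i` and `j` at level `n` are at most `Δ_n^{α'}`. -/
def SmallIncrements {Ω : Type*} {d : ℕ} (Z : Fin d → Set.Icc (0 : ℝ) 1 → Ω → ℝ)
    (i j : Fin d) (n : ℕ) (α' : ℝ) (ω : Ω) : Prop :=
  ∀ r : ℕ, 1 ≤ r → r ≤ 2 ^ n →
    |dyadicIncr Z i n r ω| ≤ mesh n ^ α' ∧ |dyadicIncr Z j n r ω| ≤ mesh n ^ α'

/-- The partial sums of the products of increments at level `n` over `l < r ≤ q` are at most
`ε₀ (q - l)^β Δ_n^{2α'}`. -/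
def SmallProductSums {Ω : Type*} {d : ℕ} (Z : Fin d → Set.Icc (0 : ℝ) 1 → Ω → ℝ)
    (i j : Fin d) (n : ℕ) (α' β ε₀ : ℝ) (ω : Ω) : Prop :=
  ∀ l q : ℕ, l < q → q ≤ 2 ^ n →
    |∑ r ∈ Finset.Icc (l + 1) q, dyadicIncr Z i n r ω * dyadicIncr Z j n r ω|
      ≤ ε₀ * ((q : ℝ) - (l : ℝ)) ^ β * mesh n ^ (2 * α')

/-! Write each increment of order `n + m` as the mean over its dyadic block of order `n` plus a
deviation. Block sums and deviations are jointly Gaussian and uncorrelated, hence independent, and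
the block sums generate `dyadicSigma Z n`. Conditioning therefore freezes the block sums at values
`c`, and what remains is a tail estimate for a bilinear form in the deviations
(`condExp_indicator_of_indepFun`, `indepFun_blockSum_blockDeviation`).

The deviations are correlated among themselves, but by Jensen's inequality adding fresh independent
block sums can only increase the exponential moment: the factors of each product belong to different
coordinates, so the average of the form is unchanged. The result is the original independent noise
shifted by `c / M`, whose exponential moment factorizes into explicit Gaussian integrals
(`lintegral_exp_pairSum_le`). Markov's inequality with a parameter of order `1 / (v √K)`, for `K`
products and variance `v`, gives the tail bound (`measureReal_lt_abs_pairSum_le`). On the given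
event the shifts are small, and their products sum to little because they are constant on blocks
(`abs_sum_products_le`). The remaining lemmas compare exponents and constants. -/

open scoped ENNReal NNReal

/-! ### Exponential moments of Gaussian variables. -/

/-- The exponential moment of a quadratic polynomial of a centred Gaussian variable. -/
lemma lintegral_exp_quadratic_gaussianReal {v : ℝ≥0} (hv : v ≠ 0) (κ p a : ℝ)
    (hκ : 0 < 1 - 2 * κ * v) :
    ∫⁻ u, ENNReal.ofReal (Real.exp (κ * (a + u) ^ 2 + p * (a + u))) ∂gaussianReal 0 v =
      ENNReal.ofReal ((√(1 - 2 * κ * v))⁻¹ *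
        Real.exp ((p ^ 2 * v / 2 + p * a + κ * a ^ 2) / (1 - 2 * κ * v))) := by
  have hv0 : (0 : ℝ) < v := by positivity
  set δ : ℝ := 1 - 2 * κ * v with hδ
  -- Completing the square turns the tilted density into a multiple of the Gaussian density with
  -- variance `v / δ` and mean `(p * v + a) / δ - a`.
  set v' : ℝ≥0 := ⟨v / δ, by positivity⟩ with hv'
  have hv'c : (v' : ℝ) = v / δ := rfl
  have hv'0 : v' ≠ 0 := by
    rw [← NNReal.coe_ne_zero, hv'c]; positivity
  have key : ∀ u : ℝ, gaussianPDFReal 0 v u * Real.exp (κ * (a + u) ^ 2 + p * (a + u)) =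
      ((√δ)⁻¹ * Real.exp ((p ^ 2 * v / 2 + p * a + κ * a ^ 2) / δ)) *
        gaussianPDFReal ((p * v + a) / δ - a) v' u := by
    intro u
    simp only [gaussianPDFReal, hv'c]
    have h1 : √(2 * Real.pi * (v / δ)) = √(2 * Real.pi * v) / √δ := by
      rw [← Real.sqrt_div (by positivity)]; congr 1; ring
    have h2 : (√δ) ≠ 0 := by positivity
    have h3 : √(2 * Real.pi * v) ≠ 0 := by positivity
    have h4 : Real.exp (-(u - 0) ^ 2 / (2 * v)) * Real.exp (κ * (a + u) ^ 2 + p * (a + u)) =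
        Real.exp ((p ^ 2 * v / 2 + p * a + κ * a ^ 2) / δ) *
          Real.exp (-(u - ((p * v + a) / δ - a)) ^ 2 / (2 * (v / δ))) := by
      rw [← Real.exp_add, ← Real.exp_add]
      congr 1
      have : κ = (1 - δ) / (2 * v) := by rw [hδ]; field_simp; ring
      rw [this]
      field_simp
      ring
    rw [h1]
    calc _ = (√(2 * Real.pi * v))⁻¹ * (Real.exp (-(u - 0) ^ 2 / (2 * v)) *
          Real.exp (κ * (a + u) ^ 2 + p * (a + u))) := by ring
      _ = _ := by rw [h4]; field_simp
  rw [gaussianReal_of_var_ne_zero _ hv,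
    lintegral_withDensity_eq_lintegral_mul _ (measurable_gaussianPDF 0 v) (by fun_prop)]
  have : ∀ u, (gaussianPDF 0 v * fun u ↦
      ENNReal.ofReal (Real.exp (κ * (a + u) ^ 2 + p * (a + u)))) u =
      ENNReal.ofReal ((√δ)⁻¹ * Real.exp ((p ^ 2 * v / 2 + p * a + κ * a ^ 2) / δ)) *
        gaussianPDF ((p * v + a) / δ - a) v' u := by
    intro u
    simp only [Pi.mul_apply, gaussianPDF]
    rw [← ENNReal.ofReal_mul (gaussianPDFReal_nonneg _ _ _), ← ENNReal.ofReal_mul (by positivity),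
      key]
  simp_rw [this]
  rw [lintegral_const_mul _ (measurable_gaussianPDF _ _), lintegral_gaussianPDF_eq_one _ hv'0,
    mul_one]

/-- The exponential moment of the product of two independent Gaussian variables. -/
lemma lintegral_exp_mul_of_indepFun {Ω : Type*} [MeasurableSpace Ω] {P : Measure Ω}
    [IsProbabilityMeasure P] {U V : Ω → ℝ} {v : ℝ≥0} (hv : v ≠ 0)
    (hU : HasLaw U (gaussianReal 0 v) P) (hV : HasLaw V (gaussianReal 0 v) P)
    (hUV : IndepFun U V P) (θ a b : ℝ) (hθ : 0 < 1 - (θ * v) ^ 2) :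
    ∫⁻ ω, ENNReal.ofReal (Real.exp (θ * ((a + U ω) * (b + V ω)))) ∂P =
      ENNReal.ofReal ((√(1 - (θ * v) ^ 2))⁻¹ *
        Real.exp ((θ * (a * b) + θ ^ 2 * v / 2 * (a ^ 2 + b ^ 2)) / (1 - (θ * v) ^ 2))) := by
  have hlaw : P.map (fun ω ↦ (U ω, V ω)) = (gaussianReal 0 v).prod (gaussianReal 0 v) := by
    rw [(indepFun_iff_map_prod_eq_prod_map_map hU.aemeasurable hV.aemeasurable).1 hUV,
      hU.map_eq, hV.map_eq]
  have h1 : ∫⁻ ω, ENNReal.ofReal (Real.exp (θ * ((a + U ω) * (b + V ω)))) ∂P =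
      ∫⁻ z, ENNReal.ofReal (Real.exp (θ * ((a + z.1) * (b + z.2))))
        ∂P.map (fun ω ↦ (U ω, V ω)) := by
    rw [lintegral_map' (by fun_prop) (hU.aemeasurable.prodMk hV.aemeasurable)]
  rw [h1, hlaw, lintegral_prod _ (by fun_prop)]
  have h2 : ∀ u : ℝ, ∫⁻ w, ENNReal.ofReal (Real.exp (θ * ((a + u) * (b + w)))) ∂gaussianReal 0 v =
      ENNReal.ofReal (Real.exp (θ ^ 2 * v / 2 * (a + u) ^ 2 + θ * b * (a + u))) := by
    intro u
    -- The inner exponent is linear, so `κ = 0`; integrating it leaves a quadratic exponent in `a +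
    -- u` with `κ = θ ^ 2 * v / 2`.
    have := lintegral_exp_quadratic_gaussianReal hv 0 (θ * (a + u)) b (by simp)
    simp only [zero_mul, zero_add, mul_zero, sub_zero, Real.sqrt_one, inv_one, one_mul, div_one,
      add_zero] at this
    simp_rw [← mul_assoc]
    rw [this]
    congr 2; ring
  simp only [h2]
  have hk : 1 - 2 * (θ ^ 2 * v / 2) * v = 1 - (θ * v) ^ 2 := by ring
  rw [lintegral_exp_quadratic_gaussianReal hv _ _ _ (by rw [hk]; exact hθ), hk]
  congr 4; ring

/-! ### Independence, Jensen's inequality and conditioning. -/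

/-- Functions of disjoint pairs of independent variables: the integral of the product is the
product of the integrals. -/
lemma lintegral_prod_pair_of_iIndepFun {Ω ι ρ : Type*} [MeasurableSpace Ω] {P : Measure Ω}
    {W : ι → Ω → ℝ} (hW : iIndepFun W P) (hm : ∀ s, Measurable (W s)) {p q : ρ → ι}
    (hpq : Function.Injective (Sum.elim p q)) {f : ρ → ℝ × ℝ → ℝ≥0∞} (hf : ∀ r, Measurable (f r))
    (s : Finset ρ) :
    ∫⁻ ω, ∏ r ∈ s, f r (W (p r) ω, W (q r) ω) ∂P =
      ∏ r ∈ s, ∫⁻ ω, f r (W (p r) ω, W (q r) ω) ∂P := by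
  classical
  have := hW.isProbabilityMeasure
  -- Indexing by `ρ ⊕ ρ` makes distinct pairs into disjoint finite index sets.
  have hX : iIndepFun (fun x ↦ W (Sum.elim p q x)) P := hW.precomp hpq
  induction s using Finset.cons_induction with
  | empty => simp
  | cons j s hj ih =>
    simp only [Finset.prod_cons]
    rw [← ih]
    refine lintegral_mul_eq_lintegral_mul_lintegral_of_indepFun'
      (f := fun ω ↦ f j (W (p j) ω, W (q j) ω))
      (g := fun ω ↦ ∏ r ∈ s, f r (W (p r) ω, W (q r) ω)) ?_ ?_ ?_
    · exact ((hf j).comp ((hm _).prodMk (hm _))).aemeasurable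
    · exact (Finset.measurable_prod _
        fun r _ ↦ (hf r).comp ((hm _).prodMk (hm _))).aemeasurable
    have hdisj : Disjoint (({j} : Finset ρ).disjSum {j}) (s.disjSum s) := by
      rw [Finset.disjoint_left]
      rintro (x | x) h h' <;> simp_all
    have hind := hX.indepFun_finset _ _ hdisj (fun x ↦ hm _)
    let F : ((x : ({j} : Finset ρ).disjSum {j}) → ℝ) → ℝ≥0∞ := fun x ↦
      f j (x ⟨Sum.inl j, by simp⟩, x ⟨Sum.inr j, by simp⟩)
    let G : ((x : s.disjSum s) → ℝ) → ℝ≥0∞ := fun x ↦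
      ∏ r ∈ s.attach, f r (x ⟨Sum.inl r.1, by simp⟩, x ⟨Sum.inr r.1, by simp⟩)
    have hF : Measurable F := (hf j).comp (by fun_prop)
    have hG : Measurable G := Finset.measurable_prod _ fun r _ ↦ (hf r).comp (by fun_prop)
    convert! hind.comp hF hG using 1
    · ext ω
      simp only [G, Function.comp]
      rw [← Finset.prod_attach]
      rfl

/-- Jensen's inequality for the exponential, without integrability of the exponential. -/
lemma ofReal_exp_integral_le_lintegral {Ω : Type*} [MeasurableSpace Ω] {P : Measure Ω}
    [IsProbabilityMeasure P] {f : Ω → ℝ} (hf : Integrable f P) :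
    ENNReal.ofReal (Real.exp (∫ ω, f ω ∂P)) ≤ ∫⁻ ω, ENNReal.ofReal (Real.exp (f ω)) ∂P := by
  by_cases h : Integrable (fun ω ↦ Real.exp (f ω)) P
  · rw [← ofReal_integral_eq_lintegral_ofReal h (ae_of_all _ fun _ ↦ (Real.exp_pos _).le)]
    exact ENNReal.ofReal_le_ofReal (convexOn_exp.map_integral_le Real.continuous_exp.continuousOn
      isClosed_univ (by simp) hf h)
  · have hs : AEStronglyMeasurable (fun ω ↦ Real.exp (f ω)) P :=
      Real.continuous_exp.comp_aestronglyMeasurable hf.1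
    have : ¬ ∫⁻ ω, ENNReal.ofReal (Real.exp (f ω)) ∂P < ∞ := fun h' ↦ h
      ⟨hs, (hasFiniteIntegral_iff_ofReal (ae_of_all _ fun _ ↦ (Real.exp_pos _).le)).2 h'⟩
    rw [not_lt_top_iff.1 this]
    exact le_top

/-- The conditional probability of an event depending on two independent variables, given the
first of them. -/
lemma condExp_indicator_of_indepFun {Ω E F : Type*} [MeasurableSpace Ω] {P : Measure Ω}
    [IsProbabilityMeasure P] [MeasurableSpace E] [MeasurableSpace F] [StandardBorelSpace F]
    [Nonempty F] {X : Ω → E} {Y : Ω → F} (hX : Measurable X) (hY : Measurable Y)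
    (hXY : IndepFun X Y P) {B : Set (E × F)} (hB : MeasurableSet B) :
    P⟦{ω | (X ω, Y ω) ∈ B} | MeasurableSpace.comap X inferInstance⟧ =ᵐ[P]
      fun ω ↦ P.real {ω' | (X ω, Y ω') ∈ B} := by
  -- By independence, the conditional law of `Y` given `X` is the constant kernel.
  have hlaw : P.map (fun ω ↦ (X ω, Y ω)) = P.map X ⊗ₘ Kernel.const E (P.map Y) := by
    rw [(indepFun_iff_map_prod_eq_prod_map_map hX.aemeasurable hY.aemeasurable).1 hXY,
      Measure.compProd_const]
  have hcd := ae_of_ae_map hX.aemeasurable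
    (condDistrib_ae_eq_of_measure_eq_compProd_of_measurable hX hY hlaw)
  have hce := condExp_prod_ae_eq_integral_condDistrib (μ := P) hX hY.aemeasurable
    (f := B.indicator fun _ ↦ (1 : ℝ)) (stronglyMeasurable_const.indicator hB)
    ((integrable_const (1 : ℝ)).indicator ((hX.prodMk hY) hB))
  have hset : (Set.indicator {ω | (X ω, Y ω) ∈ B} fun _ ↦ (1 : ℝ)) =
      fun ω ↦ B.indicator (fun _ ↦ (1 : ℝ)) (X ω, Y ω) := rfl
  rw [hset]
  filter_upwards [hce, hcd] with ω h1 h2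
  rw [h1, h2, Kernel.const_apply]
  have hsec : MeasurableSet {y | (X ω, y) ∈ B} := measurable_prodMk_left hB
  have : (fun y ↦ B.indicator (fun _ ↦ (1 : ℝ)) (X ω, y)) =
      Set.indicator {y | (X ω, y) ∈ B} 1 := rfl
  rw [this, integral_indicator_one hsec, map_measureReal_apply hY hsec]
  rfl

/-! ### Splitting Gaussian noise into block sums and deviations. -/

section Blocks

variable {Ω ι κ : Type*} [MeasurableSpace Ω] {W : ι → Ω → ℝ} {v : ℝ≥0} {P : Measure Ω}

/-- Independent centred Gaussian variables with common variance `v`. -/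
structure IsGaussianNoise (W : ι → Ω → ℝ) (v : ℝ≥0) (P : Measure Ω) : Prop where
  measurable : ∀ s, Measurable (W s)
  indep : iIndepFun W P
  hasLaw : ∀ s, HasLaw (W s) (gaussianReal 0 v) P

namespace IsGaussianNoise

lemma hasGaussianLaw (h : IsGaussianNoise W v P) (s : ι) : HasGaussianLaw (W s) P :=
  (h.hasLaw s).hasGaussianLaw

lemma memLp_two (h : IsGaussianNoise W v P) (s : ι) : MemLp (W s) 2 P :=
  (h.hasGaussianLaw s).memLp_two

lemma integral_eq_zero (h : IsGaussianNoise W v P) (s : ι) : ∫ ω, W s ω ∂P = 0 := by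
  rw [(h.hasLaw s).integral_eq]; simp

lemma covariance_eq [IsProbabilityMeasure P] [DecidableEq ι] (h : IsGaussianNoise W v P)
    (s t : ι) : cov[W s, W t; P] = if s = t then (v : ℝ) else 0 := by
  split_ifs with hst
  · subst hst
    rw [covariance_self (h.measurable s).aemeasurable, (h.hasLaw s).variance_eq]
    simp
  · exact (h.indep.indepFun hst).covariance_eq_zero (h.memLp_two s) (h.memLp_two t)

end IsGaussianNoise

variable [Fintype ι] [DecidableEq κ]

/-- The sum of the variables `W s` over the block `π s = b`. -/
noncomputable def blockSum (W : ι → Ω → ℝ) (π : ι → κ) (b : κ) (ω : Ω) : ℝ :=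
  ∑ s with π s = b, W s ω

/-- The deviation of `W s` from the mean of its block, for blocks of size `M`. -/
noncomputable def blockDeviation (W : ι → Ω → ℝ) (π : ι → κ) (M : ℕ) (s : ι) (ω : Ω) : ℝ :=
  W s ω - blockSum W π (π s) ω / M

variable {π : ι → κ} {M : ℕ}

lemma measurable_blockSum (hm : ∀ s, Measurable (W s)) (b : κ) : Measurable (blockSum W π b) :=
  Finset.measurable_sum _ fun s _ ↦ hm s

lemma measurable_blockDeviation (hm : ∀ s, Measurable (W s)) (s : ι) :
    Measurable (blockDeviation W π M s) :=
  (hm s).sub ((measurable_blockSum hm _).div_const _)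

namespace IsGaussianNoise

lemma memLp_two_blockSum (h : IsGaussianNoise W v P) (b : κ) : MemLp (blockSum W π b) 2 P :=
  memLp_finsetSum _ fun s _ ↦ h.memLp_two s

lemma integral_blockSum (h : IsGaussianNoise W v P) (b : κ) :
    ∫ ω, blockSum W π b ω ∂P = 0 := by
  unfold blockSum
  rw [integral_finsetSum _ fun s _ ↦ (h.hasGaussianLaw s).integrable]
  exact Finset.sum_eq_zero fun s _ ↦ h.integral_eq_zero s

lemma covariance_blockSum_right [IsProbabilityMeasure P] (h : IsGaussianNoise W v P) (s : ι) (b : κ) :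
    cov[W s, blockSum W π b; P] = if π s = b then (v : ℝ) else 0 := by
  classical
  unfold blockSum
  rw [covariance_fun_sum_right' (fun t _ ↦ h.memLp_two t) (h.memLp_two s)]
  simp [h.covariance_eq]

lemma covariance_blockSum [IsProbabilityMeasure P] (h : IsGaussianNoise W v P)
    (hM : ∀ b, (Finset.univ.filter fun s ↦ π s = b).card = M) (b c : κ) :
    cov[blockSum W π b, blockSum W π c; P] = if b = c then (M : ℝ) * v else 0 := by
  have : cov[blockSum W π b, blockSum W π c; P] =
      ∑ s with π s = b, cov[W s, blockSum W π c; P] :=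
    covariance_fun_sum_left' (fun t _ ↦ h.memLp_two t) (h.memLp_two_blockSum c)
  rw [this, Finset.sum_congr rfl (g := fun _ ↦ if b = c then (v : ℝ) else 0)]
  · rw [Finset.sum_const, hM]; split_ifs <;> simp
  · intro s hs
    rw [h.covariance_blockSum_right, (Finset.mem_filter.1 hs).2]

lemma integral_blockSum_mul_blockSum [IsProbabilityMeasure P] (h : IsGaussianNoise W v P)
    (hM : ∀ b, (Finset.univ.filter fun s ↦ π s = b).card = M) {b c : κ} (hbc : b ≠ c) :
    ∫ ω, blockSum W π b ω * blockSum W π c ω ∂P = 0 := by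
  have := covariance_eq_sub (h.memLp_two_blockSum (π := π) b) (h.memLp_two_blockSum (π := π) c)
  rw [h.covariance_blockSum hM, if_neg hbc, h.integral_blockSum, zero_mul, sub_zero] at this
  exact this.symm

/-- The block sums are independent of the deviations from the block means. -/
lemma indepFun_blockSum_blockDeviation [Fintype κ] [IsProbabilityMeasure P]
    (h : IsGaussianNoise W v P) (hM0 : M ≠ 0)
    (hM : ∀ b, (Finset.univ.filter fun s ↦ π s = b).card = M) :
    IndepFun (fun ω b ↦ blockSum W π b ω) (fun ω s ↦ blockDeviation W π M s ω) P := by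
  have hG : HasGaussianLaw (fun ω ↦ (W · ω)) P := h.indep.hasGaussianLaw h.hasGaussianLaw
  refine HasGaussianLaw.indepFun_of_covariance_eval ?_ ?_
  · let S : (ι → ℝ) →ₗ[ℝ] (κ → ℝ) := LinearMap.pi fun b ↦
      ∑ s with π s = b, LinearMap.proj s
    let D : (ι → ℝ) →ₗ[ℝ] (ι → ℝ) := LinearMap.pi fun s ↦
      LinearMap.proj s - (M : ℝ)⁻¹ • (LinearMap.proj (π s) ∘ₗ S)
    have := hG.map (LinearMap.toContinuousLinearMap (S.prod D))
    have heq : (fun ω ↦ (fun b ↦ blockSum W π b ω, fun s ↦ blockDeviation W π M s ω)) =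
        LinearMap.toContinuousLinearMap (S.prod D) ∘ fun ω ↦ (W · ω) := by
      funext ω
      refine Prod.ext (funext fun b ↦ ?_) (funext fun s ↦ ?_)
      · simp [S, blockSum]
      · simp [S, D, blockDeviation, blockSum, div_eq_inv_mul]
    rw [heq]
    exact this
  -- For `s` in block `b` both covariances equal `v`, the second as `M * v / M`; otherwise both
  -- vanish.
  · intro b s
    have hdiv : MemLp (fun ω ↦ blockSum W π (π s) ω / M) 2 P := by
      simpa [div_eq_mul_inv] using (h.memLp_two_blockSum (π := π) (π s)).mul_const (M : ℝ)⁻¹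
    have : cov[blockSum W π b, blockDeviation W π M s; P] =
        cov[blockSum W π b, W s; P] -
          cov[blockSum W π b, fun ω ↦ blockSum W π (π s) ω / M; P] :=
      covariance_fun_sub_right (h.memLp_two_blockSum b) (h.memLp_two s) hdiv
    rw [this, covariance_fun_div_right, h.covariance_blockSum hM, covariance_comm,
      h.covariance_blockSum_right]
    by_cases hb : π s = b
    · simp [hb, hM0]
    · simp [hb, Ne.symm hb]

end IsGaussianNoise

end Blocks

/-! ### The bilinear sum and its exponential moment. -/

section PairSum

variable {Ω ι κ ρ : Type*}

/-- The bilinear sum `∑ (c (π (p r)) / M + y (p r)) (c (π (q r)) / M + y (q r))`, for block sums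
`c` and deviations `y`. -/
noncomputable def pairSum (π : ι → κ) (M : ℕ) (p q : ρ → ι) (R : Finset ρ)
    (c : κ → ℝ) (y : ι → ℝ) : ℝ :=
  ∑ r ∈ R, (c (π (p r)) / M + y (p r)) * (c (π (q r)) / M + y (q r))

lemma measurable_pairSum [Fintype ι] [Fintype κ] (π : ι → κ) (M : ℕ) (p q : ρ → ι)
    (R : Finset ρ) :
    Measurable fun z : (κ → ℝ) × (ι → ℝ) ↦ pairSum π M p q R z.1 z.2 := by
  unfold pairSum
  fun_prop

variable [MeasurableSpace Ω] [Fintype ι] [DecidableEq κ]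
  {W : ι → Ω → ℝ} {v : ℝ≥0} {P : Measure Ω} [IsProbabilityMeasure P] {π : ι → κ} {M : ℕ}
  {p q : ρ → ι} {R : Finset ρ}

/-- The block sums restore the means removed from the deviations. With `c = 0` this makes the walk a
function of the independent pair of block sums and deviations. -/
lemma pairSum_blockSum_blockDeviation {Ω ι κ ρ : Type*} [Fintype ι] [DecidableEq κ]
    {W : ι → Ω → ℝ} {π : ι → κ} {M : ℕ} {p q : ρ → ι} {R : Finset ρ} (c : κ → ℝ) (ω : Ω) :
    pairSum π M p q R (fun b ↦ c b + blockSum W π b ω) (fun s ↦ blockDeviation W π M s ω) =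
      ∑ r ∈ R, (c (π (p r)) / M + W (p r) ω) * (c (π (q r)) / M + W (q r) ω) := by
  refine Finset.sum_congr rfl fun r _ ↦ ?_
  simp only [blockDeviation]
  ring

/-- Averaging over the block sums does not change the bilinear sum, since the paired indices lie
in different blocks. -/
lemma IsGaussianNoise.integral_pairSum (h : IsGaussianNoise W v P)
    (hM : ∀ b, (Finset.univ.filter fun s ↦ π s = b).card = M)
    (hpq : ∀ r, π (p r) ≠ π (q r)) (c : κ → ℝ) (y : ι → ℝ) :
    Integrable (fun ω ↦ pairSum π M p q R (fun b ↦ c b + blockSum W π b ω) y) P ∧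
      ∫ ω, pairSum π M p q R (fun b ↦ c b + blockSum W π b ω) y ∂P = pairSum π M p q R c y := by
  -- The linear terms are centred, and the last term is a product of uncorrelated sums over
  -- different blocks.
  have hexp : ∀ r ω, ((c (π (p r)) + blockSum W π (π (p r)) ω) / M + y (p r)) *
      ((c (π (q r)) + blockSum W π (π (q r)) ω) / M + y (q r)) =
      (c (π (p r)) / M + y (p r)) * (c (π (q r)) / M + y (q r)) +
      ((c (π (q r)) / M + y (q r)) / M) * blockSum W π (π (p r)) ω +
      ((c (π (p r)) / M + y (p r)) / M) * blockSum W π (π (q r)) ω +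
      (1 / M ^ 2 : ℝ) * (blockSum W π (π (p r)) ω * blockSum W π (π (q r)) ω) := by
    intro r ω; ring
  have hi1 : ∀ b, Integrable (blockSum W π b) P := fun b ↦
    (h.memLp_two_blockSum b).integrable (by norm_num)
  have hi2 : ∀ b b', Integrable (fun ω ↦ blockSum W π b ω * blockSum W π b' ω) P := fun b b' ↦
    (h.memLp_two_blockSum b).integrable_mul (h.memLp_two_blockSum b')
  have hint : ∀ r, Integrable (fun ω ↦ ((c (π (p r)) + blockSum W π (π (p r)) ω) / M + y (p r)) *
      ((c (π (q r)) + blockSum W π (π (q r)) ω) / M + y (q r))) P := by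
    intro r
    simp_rw [hexp r]
    exact (((integrable_const _).add ((hi1 _).const_mul _)).add ((hi1 _).const_mul _)).add
      ((hi2 _ _).const_mul _)
  refine ⟨integrable_finsetSum _ fun r _ ↦ hint r, ?_⟩
  unfold pairSum
  rw [integral_finsetSum _ fun r _ ↦ hint r]
  refine Finset.sum_congr rfl fun r _ ↦ ?_
  simp_rw [hexp r]
  rw [integral_add, integral_add, integral_add, integral_const, integral_const_mul,
    integral_const_mul, integral_const_mul, h.integral_blockSum, h.integral_blockSum,
    h.integral_blockSum_mul_blockSum hM (hpq r)]
  · simp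
  · exact integrable_const _
  · exact (hi1 _).const_mul _
  · exact (integrable_const _).add ((hi1 _).const_mul _)
  · exact (hi1 _).const_mul _
  · exact ((integrable_const _).add ((hi1 _).const_mul _)).add ((hi1 _).const_mul _)
  · exact (hi2 _ _).const_mul _

/-- Exponential moment of the bilinear sum with frozen block sums. -/
lemma IsGaussianNoise.lintegral_exp_pairSum_le [Fintype κ] (h : IsGaussianNoise W v P) (hv : v ≠ 0)
    (hM0 : M ≠ 0) (hM : ∀ b, (Finset.univ.filter fun s ↦ π s = b).card = M)
    (hinj : Function.Injective (Sum.elim p q)) (hpq : ∀ r, π (p r) ≠ π (q r))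
    (c : κ → ℝ) (θ : ℝ) (hθ : 0 < 1 - (θ * v) ^ 2) :
    ∫⁻ ω, ENNReal.ofReal (Real.exp (θ *
        pairSum π M p q R c (fun s ↦ blockDeviation W π M s ω))) ∂P ≤
      ENNReal.ofReal ((√(1 - (θ * v) ^ 2))⁻¹ ^ R.card * Real.exp
        ((θ * ∑ r ∈ R, c (π (p r)) / M * (c (π (q r)) / M) + θ ^ 2 * v / 2 *
          ∑ r ∈ R, ((c (π (p r)) / M) ^ 2 + (c (π (q r)) / M) ^ 2)) / (1 - (θ * v) ^ 2))) := by
  have hL : Measurable (fun ω b ↦ blockSum W π b ω) :=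
    measurable_pi_lambda _ fun b ↦ measurable_blockSum h.measurable b
  have hD : Measurable (fun ω s ↦ blockDeviation W π M s ω) :=
    measurable_pi_lambda _ fun s ↦ measurable_blockDeviation h.measurable s
  have hlaw := (indepFun_iff_map_prod_eq_prod_map_map hL.aemeasurable hD.aemeasurable).1
    (h.indepFun_blockSum_blockDeviation hM0 hM)
  have hmeas : Measurable fun z : (κ → ℝ) × (ι → ℝ) ↦
      ENNReal.ofReal (Real.exp (θ * pairSum π M p q R (fun b ↦ c b + z.1 b) z.2)) := by
    have : Measurable fun z : (κ → ℝ) × (ι → ℝ) ↦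
        pairSum π M p q R (fun b ↦ c b + z.1 b) z.2 :=
      (measurable_pairSum π M p q R).comp (by fun_prop :
        Measurable fun z : (κ → ℝ) × (ι → ℝ) ↦ ((fun b ↦ c b + z.1 b), z.2))
    fun_prop
  have : IsProbabilityMeasure (P.map fun ω b ↦ blockSum W π b ω) :=
    Measure.isProbabilityMeasure_map hL.aemeasurable
  have : IsProbabilityMeasure (P.map fun ω s ↦ blockDeviation W π M s ω) :=
    Measure.isProbabilityMeasure_map hD.aemeasurable
  -- Jensen's inequality over a fresh sample `ω'` of the block sums, with the deviations fixed at
  -- `ω`. Independence then merges the two samples into one.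
  calc _ ≤ ∫⁻ ω, ∫⁻ ω', ENNReal.ofReal (Real.exp (θ * pairSum π M p q R
        (fun b ↦ c b + blockSum W π b ω') (fun s ↦ blockDeviation W π M s ω))) ∂P ∂P := by
        refine lintegral_mono fun ω ↦ ?_
        obtain ⟨h1, h2⟩ := h.integral_pairSum (R := R) hM hpq c
          (fun s ↦ blockDeviation W π M s ω)
        have := ofReal_exp_integral_le_lintegral (h1.const_mul θ)
        rwa [integral_const_mul, h2] at this
    _ = ∫⁻ y, ∫⁻ x, ENNReal.ofReal (Real.exp (θ * pairSum π M p q R (fun b ↦ c b + x b) y))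
        ∂P.map (fun ω b ↦ blockSum W π b ω) ∂P.map (fun ω s ↦ blockDeviation W π M s ω) := by
        rw [lintegral_map (Measurable.lintegral_prod_left' hmeas) hD]
        refine lintegral_congr fun ω ↦ ?_
        exact (lintegral_map (hmeas.comp measurable_prodMk_right) hL).symm
    _ = ∫⁻ ω, ENNReal.ofReal (Real.exp (θ * pairSum π M p q R
        (fun b ↦ c b + blockSum W π b ω) (fun s ↦ blockDeviation W π M s ω))) ∂P := by
        rw [← lintegral_prod_symm' _ hmeas, ← hlaw, lintegral_map hmeas (hL.prodMk hD)]
    _ = ∫⁻ ω, ∏ r ∈ R, ENNReal.ofReal (Real.exp (θ *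
        ((c (π (p r)) / M + W (p r) ω) * (c (π (q r)) / M + W (q r) ω)))) ∂P := by
        refine lintegral_congr fun ω ↦ ?_
        rw [pairSum_blockSum_blockDeviation, Finset.mul_sum, Real.exp_sum,
          ENNReal.ofReal_prod_of_nonneg fun _ _ ↦ (Real.exp_pos _).le]
    _ = ∏ r ∈ R, ENNReal.ofReal ((√(1 - (θ * v) ^ 2))⁻¹ * Real.exp
        ((θ * (c (π (p r)) / M * (c (π (q r)) / M)) + θ ^ 2 * v / 2 *
          ((c (π (p r)) / M) ^ 2 + (c (π (q r)) / M) ^ 2)) / (1 - (θ * v) ^ 2))) := by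
        rw [lintegral_prod_pair_of_iIndepFun h.indep h.measurable hinj
          (f := fun r z ↦ ENNReal.ofReal (Real.exp (θ *
            ((c (π (p r)) / M + z.1) * (c (π (q r)) / M + z.2))))) (fun r ↦ by fun_prop)]
        refine Finset.prod_congr rfl fun r _ ↦ ?_
        exact lintegral_exp_mul_of_indepFun hv (h.hasLaw _) (h.hasLaw _)
          (h.indep.indepFun fun e ↦ hpq r (congrArg π e)) θ _ _ hθ
    _ = _ := by
        rw [← ENNReal.ofReal_prod_of_nonneg fun _ _ ↦ by positivity, Finset.prod_mul_distrib,
          Finset.prod_const, ← Real.exp_sum, ← Finset.sum_div, Finset.sum_add_distrib,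
          ← Finset.mul_sum, ← Finset.mul_sum]

end PairSum

/-! ### Tail bound for the bilinear sum. -/

/-- The exponential Markov inequality in terms of the lower integral. -/
lemma measureReal_lt_le_of_lintegral_exp_le {Ω : Type*} [MeasurableSpace Ω] {P : Measure Ω}
    {S : Ω → ℝ} (hS : Measurable S) {B : ℝ} (hB : 0 ≤ B) {θ : ℝ} (hθ : 0 ≤ θ)
    (h : ∫⁻ ω, ENNReal.ofReal (Real.exp (θ * S ω)) ∂P ≤ ENNReal.ofReal B) (T : ℝ) :
    P.real {ω | T < S ω} ≤ Real.exp (-(θ * T)) * B := by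
  have h1 := mul_meas_ge_le_lintegral₀ (μ := P)
    (f := fun ω ↦ ENNReal.ofReal (Real.exp (θ * S ω)))
    (by fun_prop) (ENNReal.ofReal (Real.exp (θ * T)))
  have h2 : P {ω | T < S ω} ≤
      P {ω | ENNReal.ofReal (Real.exp (θ * T)) ≤ ENNReal.ofReal (Real.exp (θ * S ω))} :=
    measure_mono fun ω (hω : T < S ω) ↦ ENNReal.ofReal_le_ofReal
      (Real.exp_le_exp.2 (mul_le_mul_of_nonneg_left hω.le hθ))
  have h3 : ENNReal.ofReal (Real.exp (θ * T)) * P {ω | T < S ω} ≤ ENNReal.ofReal B :=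
    (mul_le_mul_right h2 _).trans (h1.trans h)
  have h4 := ENNReal.toReal_mono ENNReal.ofReal_ne_top h3
  rw [ENNReal.toReal_mul, ENNReal.toReal_ofReal (Real.exp_pos _).le, ENNReal.toReal_ofReal hB]
    at h4
  rw [Real.exp_neg, ← div_eq_inv_mul, le_div_iff₀' (Real.exp_pos _)]
  exact h4

/-- Keeps the product of the `K` Gaussian prefactors bounded when `(θ * v) ^ 2 = 1 / (4 * K)`. It
rests on `(1 - 1 / (4 * K))⁻¹ ≤ 1 + 1 / (3 * K)`. -/
lemma inv_sqrt_one_sub_pow_le_exp {K : ℕ} (hK : K ≠ 0) :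
    (√(1 - 1 / (4 * (K : ℝ))))⁻¹ ^ K ≤ Real.exp (1 / 6) := by
  have hK1 : (1 : ℝ) ≤ K := by exact_mod_cast Nat.one_le_iff_ne_zero.2 hK
  have h0 : (0 : ℝ) < 1 - 1 / (4 * K) := by
    rw [sub_pos, div_lt_one (by positivity)]; linarith
  have h1 : (1 - 1 / (4 * (K : ℝ)))⁻¹ ≤ Real.exp (1 / (3 * K)) := by
    refine le_trans ?_ (Real.add_one_le_exp _)
    rw [inv_le_iff_one_le_mul₀' h0]
    have : (1 - 1 / (4 * (K : ℝ))) * (1 / (3 * K) + 1) - 1 = (K - 1) / (12 * K ^ 2) := by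
      field_simp; ring
    have h' : 0 ≤ ((K : ℝ) - 1) / (12 * K ^ 2) := div_nonneg (by linarith) (by positivity)
    linarith
  have h2 : (√(1 - 1 / (4 * (K : ℝ))))⁻¹ ≤ Real.exp (1 / (6 * K)) := by
    rw [← Real.sqrt_inv, Real.sqrt_le_left (Real.exp_pos _).le, ← Real.exp_nat_mul]
    refine h1.trans (le_of_eq ?_)
    congr 1; push_cast; field_simp; norm_num
  calc _ ≤ Real.exp (1 / (6 * K)) ^ K := pow_le_pow_left₀ (by positivity) h2 _
    _ = _ := by rw [← Real.exp_nat_mul]; congr 1; field_simp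

section PairSum

variable {Ω ι κ ρ : Type*} [MeasurableSpace Ω] [Fintype ι] [Fintype κ] [DecidableEq κ]
  {W : ι → Ω → ℝ} {v : ℝ≥0} {P : Measure Ω} [IsProbabilityMeasure P] {π : ι → κ} {M : ℕ}
  {p q : ρ → ι} {R : Finset ρ}

/-- Tail bound for the bilinear sum with frozen block sums. -/
lemma IsGaussianNoise.measureReal_lt_abs_pairSum_le (h : IsGaussianNoise W v P) (hv : v ≠ 0)
    (hM0 : M ≠ 0) (hM : ∀ b, (Finset.univ.filter fun s ↦ π s = b).card = M)
    (hinj : Function.Injective (Sum.elim p q)) (hpq : ∀ r, π (p r) ≠ π (q r))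
    (hR : R.card ≠ 0) (c : κ → ℝ) {A C : ℝ}
    (hA : ∀ r ∈ R, |c (π (p r)) / M| ≤ A ∧ |c (π (q r)) / M| ≤ A)
    (hC : |∑ r ∈ R, c (π (p r)) / M * (c (π (q r)) / M)| ≤ C) (T : ℝ) :
    P.real {ω | T < |pairSum π M p q R c (fun s ↦ blockDeviation W π M s ω)|} ≤
      2 * Real.exp (-(T / (2 * v * √R.card)) +
        4 / 3 * (C / (2 * v * √R.card) + A ^ 2 / (4 * v)) + 1 / 6) := by
  have hv0 : (0 : ℝ) < v := by positivity
  have hK1 : (1 : ℝ) ≤ R.card := by exact_mod_cast Nat.one_le_iff_ne_zero.2 hR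
  set K : ℝ := (R.card : ℝ) with hK
  have hsK : 0 < √K := Real.sqrt_pos.2 (by linarith)
  have hsq : √K ^ 2 = K := Real.sq_sqrt (by linarith)
  have hC0 : 0 ≤ C := (abs_nonneg _).trans hC
  -- The sum of `K` independent products has standard deviation `v * √K`. At this scale the
  -- quadratic term is at most `A ^ 2 / (4 * v)`, free of `K`.
  set θ : ℝ := 1 / (2 * v * √K) with hθ
  have hθ0 : 0 < θ := by positivity
  have hθv : (θ * v) ^ 2 = 1 / (4 * K) := by
    rw [hθ, mul_pow, div_pow, mul_pow, hsq]; field_simp; norm_num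
  -- Source of the factor `4 / 3` in the exponent.
  have hδ : 3 / 4 ≤ 1 - 1 / (4 * K) := by
    have : 1 / (4 * K) ≤ 1 / 4 := one_div_le_one_div_of_le (by norm_num) (by linarith)
    linarith
  set S : Ω → ℝ := fun ω ↦ pairSum π M p q R c (fun s ↦ blockDeviation W π M s ω)
  have hS : Measurable S := (measurable_pairSum π M p q R).comp
    (measurable_const.prodMk (measurable_pi_lambda _ fun s ↦
      measurable_blockDeviation h.measurable s))
  have hsum2 : ∑ r ∈ R, ((c (π (p r)) / M) ^ 2 + (c (π (q r)) / M) ^ 2) ≤ K * (2 * A ^ 2) := by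
    refine (Finset.sum_le_card_nsmul R _ (2 * A ^ 2) fun r hr ↦ ?_).trans (by simp [hK])
    have h1 := sq_le_sq' (abs_le.1 (hA r hr).1).1 (abs_le.1 (hA r hr).1).2
    have h2 := sq_le_sq' (abs_le.1 (hA r hr).2).1 (abs_le.1 (hA r hr).2).2
    linarith
  set E : ℝ := 4 / 3 * (C / (2 * v * √K) + A ^ 2 / (4 * v)) with hE
  have hmgf : ∀ η : ℝ, η = θ ∨ η = -θ →
      ∫⁻ ω, ENNReal.ofReal (Real.exp (η * S ω)) ∂P ≤
        ENNReal.ofReal (Real.exp (1 / 6) * Real.exp E) := by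
    intro η hη
    have hηv : (η * v) ^ 2 = 1 / (4 * K) := by
      rcases hη with rfl | rfl
      · exact hθv
      · rw [← hθv]; ring
    have hη2 : η ^ 2 = θ ^ 2 := by rcases hη with rfl | rfl <;> ring
    have hηabs : |η| = θ := by rcases hη with rfl | rfl <;> simp [abs_of_pos hθ0]
    refine (h.lintegral_exp_pairSum_le hv hM0 hM hinj hpq c η
      (by rw [hηv]; linarith)).trans (ENNReal.ofReal_le_ofReal ?_)
    rw [hηv]
    refine mul_le_mul (inv_sqrt_one_sub_pow_le_exp hR) (Real.exp_le_exp.2 ?_)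
      (Real.exp_pos _).le (Real.exp_pos _).le
    rw [div_le_iff₀ (by linarith)]
    have h1 : η * ∑ r ∈ R, c (π (p r)) / M * (c (π (q r)) / M) ≤ C / (2 * v * √K) := by
      refine (le_abs_self _).trans ?_
      rw [abs_mul, hηabs]
      refine (mul_le_mul_of_nonneg_left hC hθ0.le).trans (le_of_eq ?_)
      rw [hθ]; ring
    have h2 : η ^ 2 * v / 2 * ∑ r ∈ R, ((c (π (p r)) / M) ^ 2 + (c (π (q r)) / M) ^ 2) ≤
        A ^ 2 / (4 * v) := by
      refine (mul_le_mul_of_nonneg_left hsum2 (by positivity)).trans (le_of_eq ?_)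
      rw [hη2, hθ, div_pow, mul_pow, hsq]; field_simp; ring
    have h3 : 0 ≤ C / (2 * v * √K) + A ^ 2 / (4 * v) := by positivity
    rw [hE]
    nlinarith
  have hone : ∀ U : Ω → ℝ, Measurable U →
      ∫⁻ ω, ENNReal.ofReal (Real.exp (θ * U ω)) ∂P ≤
        ENNReal.ofReal (Real.exp (1 / 6) * Real.exp E) →
      P.real {ω | T < U ω} ≤ Real.exp (-(T / (2 * v * √K)) + E + 1 / 6) := by
    intro U hU hU'
    refine (measureReal_lt_le_of_lintegral_exp_le hU (by positivity) hθ0.le hU' T).trans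
      (le_of_eq ?_)
    rw [← Real.exp_add, ← Real.exp_add]
    congr 1
    rw [hθ]; ring
  have hpos := hone S hS (hmgf θ (Or.inl rfl))
  have hneg := hone (fun ω ↦ -S ω) hS.neg (by
    refine le_trans (le_of_eq ?_) (hmgf (-θ) (Or.inr rfl))
    refine lintegral_congr fun ω ↦ ?_
    rw [mul_neg, neg_mul])
  have hsub : {ω | T < |S ω|} ⊆ {ω | T < S ω} ∪ {ω | T < -S ω} := fun ω (hω : T < |S ω|) ↦
    Set.mem_union _ _ _ |>.2 (lt_abs.1 hω)
  calc P.real {ω | T < |S ω|} ≤ P.real {ω | T < S ω} + P.real {ω | T < -S ω} :=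
        (measureReal_mono hsub).trans (measureReal_union_le _ _)
    _ ≤ _ := by rw [two_mul]; exact add_le_add hpos hneg

end PairSum

/-! ### Block-constant sums and final constants. -/

lemma sum_range_div_block (f : ℕ → ℝ) {M : ℕ} (hM : 0 < M) (k : ℕ) :
    ∑ r ∈ Finset.range k, f (r / M) =
      M * ∑ b ∈ Finset.range (k / M), f b + (k % M : ℕ) * f (k / M) := by
  -- Allowing `s = M` lets the induction step absorb a complete block.
  have key : ∀ q s, s ≤ M → ∑ r ∈ Finset.range (M * q + s), f (r / M) =
      M * ∑ b ∈ Finset.range q, f b + s * f q := by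
    intro q
    induction q with
    | zero =>
      intro s hs
      rw [Finset.sum_congr rfl (g := fun _ ↦ f 0)]
      · simp
      · intro r hr
        rw [Nat.div_eq_of_lt]
        have := Finset.mem_range.1 hr
        omega
    | succ q ih =>
      intro s hs
      have hlast : ∑ r ∈ Finset.range s, f ((M * q + M + r) / M) = s * f (q + 1) := by
        rw [Finset.sum_congr rfl (g := fun _ ↦ f (q + 1))]
        · simp
        · intro r hr
          rw [show M * q + M + r = r + M * (q + 1) by ring, Nat.add_mul_div_left _ _ hM]
          rw [Nat.div_eq_of_lt ((Finset.mem_range.1 hr).trans_le hs), zero_add]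
      rw [Finset.sum_range_add, Nat.mul_succ, ih M le_rfl, Finset.sum_range_succ, hlast]
      ring
  conv_lhs => rw [← Nat.div_add_mod k M]
  exact key _ _ (Nat.mod_lt k hM).le

/-- A block-constant sum is controlled by the sums over full blocks and two boundary blocks. -/
lemma abs_sum_Ico_div_block_le {f : ℕ → ℝ} {M N k k' : ℕ} (hM : 0 < M) (hkk' : k < k')
    (hk' : k' ≤ N * M) {F G β : ℝ} (hβ : 0 ≤ β) (hG : 0 ≤ G) (hF0 : 0 ≤ F)
    (hF : ∀ b < N, |f b| ≤ F)
    (hS : ∀ l q, l < q → q ≤ N → |∑ b ∈ Finset.Ico l q, f b| ≤ G * ((q : ℝ) - l) ^ β) :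
    |∑ r ∈ Finset.Ico k k', f (r / M)| ≤
      M * (G * ((k' : ℝ) - k) ^ β) + 2 * M * F := by
  have hq : k / M ≤ k' / M := Nat.div_le_div_right hkk'.le
  have hqN : k' / M ≤ N := Nat.div_le_of_le_mul (by rwa [mul_comm])
  have hpart : ∀ a ≤ k', |((a % M : ℕ) : ℝ) * f (a / M)| ≤ M * F := by
    intro a ha
    rw [abs_mul, Nat.abs_cast]
    -- When `a = N * M` the index `a / M = N` is outside the range of `hF`, but its coefficient is
    -- zero.
    by_cases h0 : a % M = 0
    · simp only [h0, Nat.cast_zero, zero_mul]; positivity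
    · have hlt : a / M < N := by
        rw [Nat.div_lt_iff_lt_mul hM]
        refine lt_of_le_of_ne (ha.trans hk') fun e ↦ h0 ?_
        rw [e, Nat.mul_mod_left]
      exact mul_le_mul (by exact_mod_cast (Nat.mod_lt a hM).le) (hF _ hlt) (abs_nonneg _)
        (by positivity)
  have hmid : |∑ b ∈ Finset.Ico (k / M) (k' / M), f b| ≤ G * ((k' : ℝ) - k) ^ β := by
    rcases hq.eq_or_lt with e | hlt
    · rw [e]
      have : (0 : ℝ) ≤ (k' : ℝ) - k := by
        rw [sub_nonneg]; exact_mod_cast hkk'.le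
      simp only [Finset.Ico_self, Finset.sum_empty, abs_zero]
      positivity
    · refine (hS _ _ hlt hqN).trans (mul_le_mul_of_nonneg_left ?_ hG)
      have h1 : ((k / M : ℕ) : ℝ) ≤ (k' / M : ℕ) := by exact_mod_cast hq
      refine Real.rpow_le_rpow (by linarith) ?_ hβ
      have h2 : k' / M + k ≤ k' + k / M := by
        have e : k' / M ≤ k / M + (k' - k) := by
          rw [Nat.div_le_iff_le_mul_add_pred hM]
          have h3 := Nat.div_add_mod k M
          have h4 := Nat.mod_lt k hM
          have h5 : k' - k ≤ M * (k' - k) := Nat.le_mul_of_pos_left _ hM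
          rw [mul_add]
          omega
        omega
      have h3 : ((k' / M : ℕ) : ℝ) + k ≤ k' + (k / M : ℕ) := by exact_mod_cast h2
      linarith
  rw [Finset.sum_Ico_eq_sub _ hkk'.le, sum_range_div_block f hM, sum_range_div_block f hM]
  rw [Finset.sum_Ico_eq_sub _ hq] at hmid
  have e : (M * ∑ b ∈ Finset.range (k' / M), f b + (k' % M : ℕ) * f (k' / M)) -
      (M * ∑ b ∈ Finset.range (k / M), f b + (k % M : ℕ) * f (k / M)) =
      M * (∑ b ∈ Finset.range (k' / M), f b - ∑ b ∈ Finset.range (k / M), f b) +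
        (k' % M : ℕ) * f (k' / M) - (k % M : ℕ) * f (k / M) := by ring
  rw [e]
  refine (abs_sub _ _).trans ((add_le_add_left (abs_add_le _ _) _).trans ?_)
  have h1 := hpart k' le_rfl
  have h2 := hpart k hkk'.le
  have h3 : |(M : ℝ) * (∑ b ∈ Finset.range (k' / M), f b - ∑ b ∈ Finset.range (k / M), f b)| ≤
      M * (G * ((k' : ℝ) - k) ^ β) := by
    rw [abs_mul, Nat.abs_cast]
    exact mul_le_mul_of_nonneg_left hmid (by positivity)
  linarith

/-- For `x ≥ 5 / 2` the coefficient of `ρ` is nonpositive, so `ρ` may be replaced by `1`, and `2 * e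
≤ 8`. For smaller `x` the right side is at least `4`, while `y ≤ 1`. -/
lemma le_eight_mul_exp_of_le {y x ρ γ : ℝ} (hy : y ≤ 1) (hρ : 1 ≤ ρ) (hx : 0 ≤ x)
    (hγ : γ ≤ 1 / 4) (h : y ≤ 2 * Real.exp (-(ρ * x / 3) + 5 * ρ / 6 + 1 / 6)) :
    y ≤ 8 * Real.exp (-(1 / 2) * γ * x) := by
  rcases le_total (5 / 2) x with h1 | h1
  · have h2 : -(ρ * x / 3) + 5 * ρ / 6 + 1 / 6 ≤ 1 + -(1 / 2) * γ * x := by nlinarith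
    refine h.trans ((mul_le_mul_of_nonneg_left (Real.exp_le_exp.2 h2) (by norm_num)).trans ?_)
    rw [Real.exp_add]
    have := Real.exp_one_lt_d9
    have h3 := Real.exp_pos (-(1 / 2) * γ * x)
    nlinarith
  · have h2 : -(1 / 2) ≤ -(1 / 2) * γ * x := by nlinarith
    have h3 := Real.add_one_le_exp (-(1 / 2) * γ * x)
    linarith

/-! ### Dyadic points and blocks. -/

lemma dyadicPoint_monotone (n : ℕ) : Monotone (dyadicPoint n) := fun a b hab ↦
  Set.monotone_projIcc _ (by gcongr)

lemma coe_dyadicPoint {n k : ℕ} (hk : k ≤ 2 ^ n) :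
    (dyadicPoint n k : ℝ) = (k : ℝ) / 2 ^ n := by
  rw [dyadicPoint, Set.projIcc_of_mem zero_le_one]
  refine ⟨by positivity, ?_⟩
  rw [div_le_one (by positivity)]
  exact_mod_cast hk

lemma dyadicPoint_add (n m k : ℕ) : dyadicPoint (n + m) (k * 2 ^ m) = dyadicPoint n k := by
  unfold dyadicPoint
  congr 1
  push_cast
  rw [pow_add, mul_div_mul_right _ _ (by positivity)]

lemma mesh_pos (n : ℕ) : 0 < mesh n := by unfold mesh; positivity

lemma mesh_le_one (n : ℕ) : mesh n ≤ 1 := by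
  unfold mesh
  rw [div_le_one (by positivity)]
  exact one_le_pow₀ (by norm_num)

lemma mesh_add (n m : ℕ) : mesh (n + m) = mesh n * mesh m := by
  unfold mesh; rw [pow_add]; field_simp

/-- The dyadic block of order `n` containing a dyadic cell of order `n + m`. -/
def dyadicBlock (d n m : ℕ) (x : Fin d × Fin (2 ^ (n + m))) : Fin d × Fin (2 ^ n) :=
  (x.1, ⟨x.2 / 2 ^ m, Nat.div_lt_of_lt_mul
    (x.2.2.trans_eq (by rw [← pow_add, add_comm]))⟩)

/-- Cells of a block are enumerated by their remainder modulo `2 ^ m`. General values in `E` cover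
both block sums and block cardinalities. -/
lemma sum_filter_dyadicBlock {E : Type*} [AddCommMonoid E] {d n m : ℕ} (g : Fin d → ℕ → E)
    (b : Fin d × Fin (2 ^ n)) :
    ∑ x with dyadicBlock d n m x = b, g x.1 x.2 =
      ∑ t ∈ Finset.range (2 ^ m), g b.1 (b.2 * 2 ^ m + t) := by
  have hpos : 0 < 2 ^ m := by positivity
  have hlt : ∀ t < 2 ^ m, (b.2 : ℕ) * 2 ^ m + t < 2 ^ (n + m) := by
    intro t ht
    have h1 : (b.2 : ℕ) + 1 ≤ 2 ^ n := b.2.2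
    calc (b.2 : ℕ) * 2 ^ m + t < (b.2 + 1) * 2 ^ m := by rw [add_mul]; omega
      _ ≤ 2 ^ n * 2 ^ m := Nat.mul_le_mul_right _ h1
      _ = _ := (pow_add _ _ _).symm
  refine Finset.sum_bij' (fun x _ ↦ (x.2 : ℕ) % 2 ^ m)
    (fun t ht ↦ (b.1, ⟨b.2 * 2 ^ m + t, hlt t (Finset.mem_range.1 ht)⟩)) ?_ ?_ ?_ ?_ ?_
  · intro x _
    exact Finset.mem_range.2 (Nat.mod_lt _ hpos)
  · intro t ht
    refine Finset.mem_filter.2 ⟨Finset.mem_univ _, Prod.ext rfl (Fin.ext ?_)⟩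
    change ((b.2 : ℕ) * 2 ^ m + t) / 2 ^ m = b.2
    rw [mul_comm, Nat.mul_add_div hpos, Nat.div_eq_of_lt (Finset.mem_range.1 ht), add_zero]
  · rintro ⟨l, s⟩ hx
    obtain rfl := (Finset.mem_filter.1 hx).2
    refine Prod.ext rfl (Fin.ext ?_)
    change (s : ℕ) / 2 ^ m * 2 ^ m + s % 2 ^ m = s
    rw [mul_comm, Nat.div_add_mod]
  · intro t ht
    change ((b.2 : ℕ) * 2 ^ m + t) % 2 ^ m = t
    rw [mul_comm, Nat.mul_add_mod, Nat.mod_eq_of_lt (Finset.mem_range.1 ht)]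
  · rintro ⟨l, s⟩ hx
    obtain rfl := (Finset.mem_filter.1 hx).2
    change g l s = g l (s / 2 ^ m * 2 ^ m + s % 2 ^ m)
    rw [mul_comm, Nat.div_add_mod]

lemma card_filter_dyadicBlock {d n m : ℕ} (b : Fin d × Fin (2 ^ n)) :
    (Finset.univ.filter fun x ↦ dyadicBlock d n m x = b).card = 2 ^ m := by
  rw [Finset.card_eq_sum_ones, sum_filter_dyadicBlock (fun _ _ ↦ 1) b]
  simp

/-! ### Brownian increments as Gaussian noise. -/

section Brownian

variable {Ω : Type*} {d : ℕ}

/-- All the increments over the dyadic cells of order `n`. -/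
noncomputable def dyadicNoise (Z : Fin d → Set.Icc (0 : ℝ) 1 → Ω → ℝ) (n : ℕ)
    (x : Fin d × Fin (2 ^ n)) (ω : Ω) : ℝ :=
  dyadicIncr Z x.1 n (x.2 + 1) ω

variable {Z : Fin d → Set.Icc (0 : ℝ) 1 → Ω → ℝ}

lemma sum_range_dyadicIncr (l : Fin d) (n a : ℕ) (c : ℕ) (ω : Ω) :
    ∑ t ∈ Finset.range c, dyadicIncr Z l n (a + t + 1) ω =
      Z l (dyadicPoint n (a + c)) ω - Z l (dyadicPoint n a) ω := by
  have := Finset.sum_range_sub (fun t ↦ Z l (dyadicPoint n (a + t)) ω) c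
  simpa [dyadicIncr, add_assoc] using this

/-- By telescoping; this identifies freezing the block sums with conditioning on the increments of
order `n`. -/
lemma blockSum_dyadicNoise (n m : ℕ) (b : Fin d × Fin (2 ^ n)) (ω : Ω) :
    blockSum (dyadicNoise Z (n + m)) (dyadicBlock d n m) b ω = dyadicNoise Z n b ω := by
  unfold blockSum dyadicNoise
  rw [sum_filter_dyadicBlock (fun l s ↦ dyadicIncr Z l (n + m) (s + 1) ω) b,
    sum_range_dyadicIncr]
  have : (b.2 : ℕ) * 2 ^ m + 2 ^ m = (b.2 + 1) * 2 ^ m := by ring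
  rw [this, dyadicPoint_add, dyadicPoint_add]
  rfl

lemma measurable_comap_dyadicNoise_sub {n m : ℕ} (hmn : m ≤ n) (l : Fin d) {a b : ℕ}
    (ha : a ≤ 2 ^ m) (hb : b ≤ 2 ^ m) :
    Measurable[MeasurableSpace.comap (fun ω x ↦ dyadicNoise Z n x ω) inferInstance]
      (fun ω ↦ Z l (dyadicPoint m b) ω - Z l (dyadicPoint m a) ω) := by
  obtain ⟨e, rfl⟩ := Nat.exists_eq_add_of_le hmn
  -- Increments from time zero suffice: their differences give the others, whatever the order of `a`
  -- and `b`.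
  have key : ∀ a ≤ 2 ^ m, Measurable[MeasurableSpace.comap
      (fun ω x ↦ dyadicNoise Z (m + e) x ω) inferInstance]
      (fun ω ↦ Z l (dyadicPoint m a) ω - Z l (dyadicPoint m 0) ω) := by
    intro a ha
    have heq : (fun ω ↦ Z l (dyadicPoint m a) ω - Z l (dyadicPoint m 0) ω) = fun ω ↦
        ∑ t ∈ (Finset.range (a * 2 ^ e)).attach, dyadicNoise Z (m + e)
          (l, ⟨t.1, (Finset.mem_range.1 t.2).trans_le
            (by rw [pow_add]; exact Nat.mul_le_mul_right _ ha)⟩) ω := by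
      funext ω
      have := sum_range_dyadicIncr (Z := Z) l (m + e) 0 (a * 2 ^ e) ω
      rw [← dyadicPoint_add m e a, ← dyadicPoint_add m e 0]
      simp only [zero_add, zero_mul] at this ⊢
      rw [← this, ← Finset.sum_attach]
      rfl
    rw [heq]
    refine Finset.measurable_sum _ fun t _ ↦ ?_
    exact (measurable_pi_apply (X := fun _ : Fin d × Fin (2 ^ (m + e)) ↦ ℝ) _).comp
      (comap_measurable (fun ω x ↦ dyadicNoise Z (m + e) x ω))
  have h := (key b hb).sub (key a ha)
  refine (congrArg _ (funext fun ω ↦ ?_)).mp h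
  simp only [Pi.sub_apply]
  ring

/-- Coarser increments are sums of those of order `n`, so a single random vector generates the
σ-algebra, as conditioning by independence requires. -/
lemma dyadicSigma_eq_comap (n : ℕ) :
    dyadicSigma Z n = MeasurableSpace.comap (fun ω x ↦ dyadicNoise Z n x ω) inferInstance := by
  apply le_antisymm
  · refine iSup_le fun m ↦ iSup_le fun hm ↦ iSup_le fun l ↦ iSup_le fun a ↦ iSup_le fun ha ↦
      iSup_le fun b ↦ iSup_le fun hb ↦ ?_
    exact (measurable_comap_dyadicNoise_sub hm l ha hb).comap_le
  · refine Measurable.comap_le (@measurable_pi_lambda _ _ _ (dyadicSigma Z n) _ _ fun x ↦ ?_)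
    have h : MeasurableSpace.comap (fun ω ↦ Z x.1 (dyadicPoint n (x.2 + 1)) ω -
        Z x.1 (dyadicPoint n x.2) ω) inferInstance ≤ dyadicSigma Z n :=
      le_iSup_of_le n <| le_iSup_of_le le_rfl <| le_iSup_of_le x.1 <|
        le_iSup_of_le (x.2 : ℕ) <| le_iSup_of_le x.2.2.le <|
        le_iSup_of_le ((x.2 : ℕ) + 1) <| le_iSup_of_le x.2.2 le_rfl
    exact Measurable.of_comap_le h

lemma isGaussianNoise_dyadicNoise [MeasurableSpace Ω] {P : Measure Ω}
    (hZ : IsUnitBrownianFamily Z P) (n : ℕ) :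
    IsGaussianNoise (dyadicNoise Z n) (mesh n).toNNReal P where
  measurable x := ((hZ.brownian x.1).measurable _).sub ((hZ.brownian x.1).measurable _)
  indep := by
    refine iIndepFun_uncurry' (X := fun l (s : Fin (2 ^ n)) ω ↦ dyadicIncr Z l n (s + 1) ω)
      (fun l s ↦ ((hZ.brownian l).measurable _).sub ((hZ.brownian l).measurable _)) ?_ ?_
    -- Independence across coordinates comes from that of the paths; within a coordinate, from
    -- independent increments.
    · exact hZ.indep.comp (fun _ (z : Set.Icc (0 : ℝ) 1 → ℝ) (s : Fin (2 ^ n)) ↦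
        z (dyadicPoint n (s + 1)) - z (dyadicPoint n s)) (fun _ ↦ by fun_prop)
    · intro l
      exact ((hZ.brownian l).indep_increments.nat (dyadicPoint_monotone n)).precomp
        Fin.val_injective
  hasLaw x := by
    have h := (hZ.brownian x.1).gaussian_increments (dyadicPoint n x.2) (dyadicPoint n (x.2 + 1))
      (dyadicPoint_monotone n (Nat.le_succ _))
    have hx : (x.2 : ℕ) + 1 ≤ 2 ^ n := x.2.2
    rw [coe_dyadicPoint hx, coe_dyadicPoint x.2.2.le] at h
    have : ((x.2 + 1 : ℕ) : ℝ) / 2 ^ n - ((x.2 : ℕ) : ℝ) / 2 ^ n = mesh n := by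
      unfold mesh; push_cast; ring
    rw [this] at h
    exact h

end Brownian

/-! ### Estimates for the walk and the conditional bound. -/

lemma sum_attachFin_val {E : Type*} [AddCommMonoid E] {N : ℕ} (s : Finset ℕ) (hs : ∀ r ∈ s, r < N)
    (g : ℕ → E) : ∑ r ∈ s.attachFin hs, g r = ∑ r ∈ s, g r := by
  conv_rhs => rw [← Finset.map_valEmbedding_attachFin hs, Finset.sum_map]
  rfl

lemma areaWalk_sub_areaWalk {Ω : Type*} {d : ℕ} (Z : Fin d → Set.Icc (0 : ℝ) 1 → Ω → ℝ)
    (i j : Fin d) (n : ℕ) {k k' : ℕ} (h : k ≤ k') (ω : Ω) :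
    areaWalk Z i j n k' ω - areaWalk Z i j n k ω =
      ∑ r ∈ Finset.Ico k k',
        dyadicIncr Z i n (2 * r + 1) ω * dyadicIncr Z j n (2 * r + 1 + 1) ω := by
  have key : ∀ k, areaWalk Z i j n k ω = ∑ r ∈ Finset.range k,
      dyadicIncr Z i n (2 * r + 1) ω * dyadicIncr Z j n (2 * r + 1 + 1) ω := by
    intro k
    induction k with
    | zero => simp [areaWalk]
    | succ k ih =>
      rw [Finset.sum_range_succ, ← ih, areaWalk, Finset.sum_Icc_succ_top (by omega)]
      rfl
  rw [key, key, Finset.sum_Ico_eq_sub _ h]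

/-- The exponent of the tail bound, for mesh sizes `δ` of the blocks and `μ` within a block. -/
lemma tail_exponent_le {α β α' ε₀ K δ μ : ℝ} {m : ℕ} (hα : α < 1 / 2) (hα' : α < α')
    (hε₀ : ε₀ ≤ 1 / 2) (hK : 1 ≤ K) (hδ0 : 0 < δ) (hδ1 : δ ≤ 1) (hμ0 : 0 < μ)
    (hμ : 2 ^ m * μ = 1 / 2) :
    -(K ^ β * (δ * μ) ^ (2 * α) / (2 * (δ * μ) * √K)) +
      4 / 3 * (μ ^ 2 * (2 ^ m * (ε₀ * δ ^ (2 * α') * K ^ β) + 2 * 2 ^ m * δ ^ (2 * α')) /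
        (2 * (δ * μ) * √K) + (δ ^ α' * μ) ^ 2 / (4 * (δ * μ))) + 1 / 6 ≤
    -(δ ^ (2 * α' - 1) * (K ^ (β - 1 / 2) * δ ^ (2 * (α - α')) * μ ^ (2 * α - 1)) / 3) +
      5 * δ ^ (2 * α' - 1) / 6 + 1 / 6 := by
  have hμ1 : μ ≤ 1 / 2 := by
    have : (1 : ℝ) ≤ 2 ^ m := one_le_pow₀ (by norm_num)
    nlinarith
  have hK0 : 0 < K := by linarith
  have hs1 : 1 ≤ √K := Real.one_le_sqrt.2 hK
  have hs0 : 0 < √K := by linarith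
  set y : ℝ := K ^ (β - 1 / 2) with hy
  have hy0 : 0 < y := Real.rpow_pos_of_pos hK0 _
  have hKy : K ^ β = y * √K := by
    rw [hy, Real.sqrt_eq_rpow, ← Real.rpow_add hK0]; congr 1; ring
  set ρ : ℝ := δ ^ (2 * α' - 1) with hρ
  have hρ0 : 0 < ρ := Real.rpow_pos_of_pos hδ0 _
  have hF : δ ^ (2 * α') = ρ * δ := by
    rw [hρ, Real.rpow_sub hδ0, Real.rpow_one]; field_simp
  have hF' : (δ ^ α') ^ 2 = ρ * δ := by
    rw [← hF, ← Real.rpow_natCast, ← Real.rpow_mul hδ0.le]; congr 1; push_cast; ring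
  set x : ℝ := y * δ ^ (2 * (α - α')) * μ ^ (2 * α - 1) with hx
  have hT : K ^ β * (δ * μ) ^ (2 * α) / (2 * (δ * μ) * √K) = ρ * x / 2 := by
    have h1 : δ ^ (2 * α) = δ * (ρ * δ ^ (2 * (α - α'))) := by
      rw [hρ, ← Real.rpow_add hδ0]
      nth_rewrite 2 [← Real.rpow_one δ]
      rw [← Real.rpow_add hδ0]; congr 1; ring
    have h2 : μ ^ (2 * α) = μ * μ ^ (2 * α - 1) := by
      rw [Real.rpow_sub hμ0, Real.rpow_one]; field_simp
    rw [Real.mul_rpow hδ0.le hμ0.le, h1, h2, hKy, hx]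
    field_simp
  have hC : μ ^ 2 * (2 ^ m * (ε₀ * δ ^ (2 * α') * K ^ β) + 2 * 2 ^ m * δ ^ (2 * α')) /
      (2 * (δ * μ) * √K) = ρ * (ε₀ * y / 4 + 1 / (2 * √K)) := by
    have h1 : (2 : ℝ) ^ m = 1 / (2 * μ) := by rw [eq_div_iff (by positivity)]; linarith
    rw [hF, hKy, h1]
    field_simp
    ring
  have hA : (δ ^ α' * μ) ^ 2 / (4 * (δ * μ)) = ρ * μ / 4 := by
    rw [mul_pow, hF']; field_simp
  rw [hT, hC, hA]
  -- Both extra factors in `x` are powers of numbers at most `1` with negative exponents.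
  have hyx : y ≤ x := by
    have h1 : 1 ≤ δ ^ (2 * (α - α')) :=
      Real.one_le_rpow_of_pos_of_le_one_of_nonpos hδ0 hδ1 (by linarith)
    have h2 : 1 ≤ μ ^ (2 * α - 1) :=
      Real.one_le_rpow_of_pos_of_le_one_of_nonpos hμ0 (by linarith) (by linarith)
    rw [hx, mul_assoc]
    exact le_mul_of_one_le_right hy0.le (one_le_mul_of_one_le_of_one_le h1 h2)
  -- The exponent is now at most `-ρ * x / 2 + 4 / 3 * (ρ * (x / 8 + 1 / 2) + ρ / 8) + 1 / 6`, which
  -- is the claimed bound.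
  have h3 : 1 / (2 * √K) ≤ 1 / 2 := one_div_le_one_div_of_le (by norm_num) (by linarith)
  have h4 : ρ * (ε₀ * y / 4 + 1 / (2 * √K)) ≤ ρ * (x / 8 + 1 / 2) :=
    mul_le_mul_of_nonneg_left (by nlinarith) hρ0.le
  have h5 : ρ * μ / 4 ≤ ρ / 8 := by nlinarith
  nlinarith

section

variable {Ω : Type*} {d : ℕ} {Z : Fin d → Set.Icc (0 : ℝ) 1 → Ω → ℝ}

/-- The sum of the products of the block means under the smallness conditions. -/
lemma abs_sum_products_le {i j : Fin d} {n m k k' : ℕ} {α' β ε₀ : ℝ} {ω : Ω} (hβ : 0 ≤ β)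
    (hε₀ : 0 ≤ ε₀) (hkk' : k < k') (hk' : k' ≤ 2 ^ (n + m))
    (h1 : SmallIncrements Z i j n α' ω) (h2 : SmallProductSums Z i j n α' β ε₀ ω) :
    |∑ r ∈ Finset.Ico k k', dyadicIncr Z i n (r / 2 ^ m + 1) ω *
        dyadicIncr Z j n (r / 2 ^ m + 1) ω| ≤
      2 ^ m * (ε₀ * mesh n ^ (2 * α') * ((k' : ℝ) - k) ^ β) + 2 * 2 ^ m * mesh n ^ (2 * α') := by
  have hpos : 0 ≤ mesh n ^ (2 * α') := Real.rpow_nonneg (mesh_pos n).le _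
  have h := abs_sum_Ico_div_block_le
    (f := fun b ↦ dyadicIncr Z i n (b + 1) ω * dyadicIncr Z j n (b + 1) ω)
    (M := 2 ^ m) (N := 2 ^ n) (F := mesh n ^ (2 * α')) (G := ε₀ * mesh n ^ (2 * α')) (β := β)
    (by positivity) hkk' (by rwa [← pow_add]) hβ (mul_nonneg hε₀ hpos) hpos ?_ ?_
  · push_cast at h
    exact h
  · intro b hb
    obtain ⟨hi, hj⟩ := h1 (b + 1) (by omega) hb
    have : mesh n ^ (2 * α') = mesh n ^ α' * mesh n ^ α' := by
      rw [← Real.rpow_add (mesh_pos n)]; congr 1; ring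
    rw [abs_mul, this]
    exact mul_le_mul hi hj (abs_nonneg _) (Real.rpow_nonneg (mesh_pos n).le _)
  · intro l q hlq hq
    have h := h2 l q hlq hq
    have e : Finset.Icc (l + 1) q = Finset.Ico (l + 1) (q + 1) := by
      ext x; simp only [Finset.mem_Icc, Finset.mem_Ico]; omega
    rw [e, ← Finset.sum_Ico_add' (fun r ↦ dyadicIncr Z i n r ω * dyadicIncr Z j n r ω)] at h
    refine h.trans (le_of_eq ?_)
    ring

end

theorem mainTheorem5 {Ω : Type*} [MeasurableSpace Ω] (P : Measure Ω) [IsProbabilityMeasure P]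
    {d : ℕ} (Z : Fin d → Set.Icc (0 : ℝ) 1 → Ω → ℝ) (hZ : IsUnitBrownianFamily Z P)
    (α β α' γ ε₀ : ℝ)
    (hα : α ∈ Set.Ioo (1 / 3 : ℝ) (1 / 2))
    (hβ : β ∈ Set.Ioo (1 - α) (2 * α))
    (hα' : α' ∈ Set.Ioo α (1 / 2))
    (hγ : γ ∈ Set.Ioc (0 : ℝ) (1 / 4))
    (hε₀ : ε₀ ∈ Set.Ioo (0 : ℝ) (1 / 2))
    (i j : Fin d) (hij : i ≠ j)
    (n m : ℕ) (hm : 1 ≤ m)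
    (k k' : ℕ) (hkk' : k < k') (hk' : k' ≤ 2 ^ (n + m - 1)) :
    ∀ᵐ ω ∂P, SmallIncrements Z i j n α' ω → SmallProductSums Z i j n α' β ε₀ ω →
      (P⟦{ω' | |areaWalk Z i j (n + m) k' ω' - areaWalk Z i j (n + m) k ω'|
          > ((k' : ℝ) - (k : ℝ)) ^ β * mesh (n + m) ^ (2 * α)} | dyadicSigma Z n⟧) ω
        ≤ 8 * Real.exp (-(1 / 2) * γ * ((k' : ℝ) - (k : ℝ)) ^ (β - 1 / 2)
            * mesh n ^ (2 * (α - α')) * mesh m ^ (2 * α - 1)) := by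
  -- From here `m + 1` replaces the original `m`: a block has `2 ^ (m + 1)` cells, hence `2 ^ m`
  -- pairs of consecutive cells.
  obtain ⟨m, rfl⟩ := Nat.exists_eq_add_of_le' hm
  have hk2 : k' ≤ 2 ^ (n + m) := hk'
  have hpow : 2 ^ (n + (m + 1)) = 2 * 2 ^ (n + m) := by rw [← add_assoc, pow_succ, mul_comm]
  set T : ℝ := ((k' : ℝ) - (k : ℝ)) ^ β * mesh (n + (m + 1)) ^ (2 * α) with hT
  let W := dyadicNoise Z (n + (m + 1))
  let π := dyadicBlock d n (m + 1)
  -- Cells are numbered from zero, so `2 * r` and `2 * r + 1` carry the increments numbered `2 * r +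
  -- 1` and `2 * r + 2`.
  let p : Fin (2 ^ (n + m)) → Fin d × Fin (2 ^ (n + (m + 1))) := fun r ↦
    (i, ⟨2 * r, by have := r.2; omega⟩)
  let q : Fin (2 ^ (n + m)) → Fin d × Fin (2 ^ (n + (m + 1))) := fun r ↦
    (j, ⟨2 * r + 1, by have := r.2; omega⟩)
  let R : Finset (Fin (2 ^ (n + m))) := (Finset.Ico k k').attachFin fun r hr ↦
    (Finset.mem_Ico.1 hr).2.trans_le hk2
  have hW : IsGaussianNoise W (mesh (n + (m + 1))).toNNReal P := isGaussianNoise_dyadicNoise hZ _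
  have hv : (mesh (n + (m + 1))).toNNReal ≠ 0 := (Real.toNNReal_pos.2 (mesh_pos _)).ne'
  have hvc : ((mesh (n + (m + 1))).toNNReal : ℝ) = mesh n * mesh (m + 1) := by
    rw [Real.coe_toNNReal _ (mesh_pos _).le, mesh_add]
  have hM0 : 2 ^ (m + 1) ≠ 0 := by positivity
  have hM : ∀ b, (Finset.univ.filter fun s ↦ π s = b).card = 2 ^ (m + 1) :=
    card_filter_dyadicBlock
  have hpq : ∀ r, π (p r) ≠ π (q r) := fun r e ↦ hij (congrArg Prod.fst e)
  have hinj : Function.Injective (Sum.elim p q) := by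
    refine Function.Injective.sumElim (fun r s e ↦ ?_) (fun r s e ↦ ?_) fun r s e ↦ ?_
    · have := congrArg (fun x ↦ (x.2 : ℕ)) e
      simp only [p] at this
      exact Fin.ext (by omega)
    · have := congrArg (fun x ↦ (x.2 : ℕ)) e
      simp only [q] at this
      exact Fin.ext (by omega)
    · exact hij (congrArg Prod.fst e)
  have hcard : R.card = k' - k := by simp [R]
  have hR : R.card ≠ 0 := by omega
  have hcardR : (R.card : ℝ) = (k' : ℝ) - k := by rw [hcard, Nat.cast_sub hkk'.le]
  have hX : (fun ω b ↦ blockSum W π b ω) = fun ω b ↦ dyadicNoise Z n b ω := by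
    funext ω b; exact blockSum_dyadicNoise n (m + 1) b ω
  have hmX : Measurable (fun ω b ↦ blockSum W π b ω) :=
    measurable_pi_lambda _ fun b ↦ measurable_blockSum hW.measurable b
  have hmY : Measurable (fun ω s ↦ blockDeviation W π (2 ^ (m + 1)) s ω) :=
    measurable_pi_lambda _ fun s ↦ measurable_blockDeviation hW.measurable s
  have hind := hW.indepFun_blockSum_blockDeviation hM0 hM
  let B : Set ((Fin d × Fin (2 ^ n) → ℝ) × (Fin d × Fin (2 ^ (n + (m + 1))) → ℝ)) :=
    {z | T < |pairSum π (2 ^ (m + 1)) p q R z.1 z.2|}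
  have hB : MeasurableSet B := measurableSet_lt measurable_const
    (measurable_pairSum π (2 ^ (m + 1)) p q R).abs
  have hcond := condExp_indicator_of_indepFun hmX hmY hind hB
  have hevent : {ω' | |areaWalk Z i j (n + (m + 1)) k' ω' - areaWalk Z i j (n + (m + 1)) k ω'|
      > T} = {ω | ((fun b ↦ blockSum W π b ω), fun s ↦ blockDeviation W π (2 ^ (m + 1)) s ω)
        ∈ B} := by
    ext ω
    have h0 := pairSum_blockSum_blockDeviation (W := W) (π := π) (M := 2 ^ (m + 1)) (p := p)
      (q := q) (R := R) (fun _ ↦ 0) ω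
    simp only [zero_add, zero_div] at h0
    have h1 := areaWalk_sub_areaWalk Z i j (n + (m + 1)) hkk'.le ω
    rw [← sum_attachFin_val (Finset.Ico k k') (N := 2 ^ (n + m))
      (fun r hr ↦ (Finset.mem_Ico.1 hr).2.trans_le hk2)] at h1
    simp only [Set.mem_ofPred_eq, B, h0, h1]
    rfl
  rw [dyadicSigma_eq_comap n, ← hX, hevent]
  filter_upwards [hcond] with ω hω h1 h2
  rw [hω]
  have hX' : (fun b ↦ blockSum W π b ω) = fun b ↦ dyadicNoise Z n b ω := congrFun hX ω
  have hinv : ∀ y : ℝ, y / ((2 ^ (m + 1) : ℕ) : ℝ) = y * mesh (m + 1) := by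
    intro y; unfold mesh; push_cast; ring
  -- Both cells of a pair lie in the same time block, so the frozen means multiply to the same-time
  -- products controlled by `SmallProductSums`.
  have hdivp : ∀ r : ℕ, 2 * r / 2 ^ (m + 1) = r / 2 ^ m := by
    intro r; rw [pow_succ', Nat.mul_div_mul_left _ _ (by norm_num)]
  have hdivq : ∀ r : ℕ, (2 * r + 1) / 2 ^ (m + 1) = r / 2 ^ m := by
    intro r; rw [pow_succ', ← Nat.div_div_eq_div_mul]; congr 1; omega
  have hcp : ∀ r, dyadicNoise Z n (π (p r)) ω = dyadicIncr Z i n ((r : ℕ) / 2 ^ m + 1) ω := by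
    intro r; simp only [dyadicNoise, π, p, dyadicBlock, hdivp]
  have hcq : ∀ r, dyadicNoise Z n (π (q r)) ω = dyadicIncr Z j n ((r : ℕ) / 2 ^ m + 1) ω := by
    intro r; simp only [dyadicNoise, π, q, dyadicBlock, hdivq]
  have hblt : ∀ r : Fin (2 ^ (n + m)), (r : ℕ) / 2 ^ m + 1 ≤ 2 ^ n := fun r ↦
    Nat.div_lt_of_lt_mul (r.2.trans_eq (by rw [← pow_add, add_comm]))
  have hA : ∀ r ∈ R,
      |dyadicNoise Z n (π (p r)) ω / (2 ^ (m + 1) : ℕ)| ≤ mesh n ^ α' * mesh (m + 1) ∧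
      |dyadicNoise Z n (π (q r)) ω / (2 ^ (m + 1) : ℕ)| ≤ mesh n ^ α' * mesh (m + 1) := by
    intro r _
    obtain ⟨hi, hj⟩ := h1 ((r : ℕ) / 2 ^ m + 1) (Nat.le_add_left _ _) (hblt r)
    rw [hcp, hcq, hinv, hinv, abs_mul, abs_mul, abs_of_pos (mesh_pos (m + 1))]
    exact ⟨mul_le_mul_of_nonneg_right hi (mesh_pos _).le,
      mul_le_mul_of_nonneg_right hj (mesh_pos _).le⟩
  have hβ0 : 0 ≤ β := by linarith [hβ.1, hα.2]
  have hC : |∑ r ∈ R, dyadicNoise Z n (π (p r)) ω / (2 ^ (m + 1) : ℕ) *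
      (dyadicNoise Z n (π (q r)) ω / (2 ^ (m + 1) : ℕ))| ≤
      mesh (m + 1) ^ 2 * (2 ^ m * (ε₀ * mesh n ^ (2 * α') * ((k' : ℝ) - k) ^ β) +
        2 * 2 ^ m * mesh n ^ (2 * α')) := by
    have e : ∑ r ∈ R, dyadicNoise Z n (π (p r)) ω / (2 ^ (m + 1) : ℕ) *
        (dyadicNoise Z n (π (q r)) ω / (2 ^ (m + 1) : ℕ)) =
        mesh (m + 1) ^ 2 * ∑ r ∈ Finset.Ico k k', dyadicIncr Z i n (r / 2 ^ m + 1) ω *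
          dyadicIncr Z j n (r / 2 ^ m + 1) ω := by
      rw [← sum_attachFin_val (Finset.Ico k k') (N := 2 ^ (n + m))
        (fun r hr ↦ (Finset.mem_Ico.1 hr).2.trans_le hk2), Finset.mul_sum]
      refine Finset.sum_congr rfl fun r _ ↦ ?_
      rw [hcp, hcq, hinv, hinv]
      ring
    rw [e, abs_mul, abs_of_nonneg (sq_nonneg _)]
    exact mul_le_mul_of_nonneg_left (abs_sum_products_le hβ0 hε₀.1.le hkk' hk2 h1 h2)
      (sq_nonneg _)
  have htail := hW.measureReal_lt_abs_pairSum_le hv hM0 hM hinj hpq hR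
    (fun b ↦ dyadicNoise Z n b ω) hA hC T
  have hK1 : (1 : ℝ) ≤ (k' : ℝ) - k := by
    rw [← hcardR]; exact_mod_cast Nat.one_le_iff_ne_zero.2 hR
  have hμ : 2 ^ m * mesh (m + 1) = 1 / 2 := by
    unfold mesh; rw [pow_succ]; field_simp
  have hexp := tail_exponent_le (β := β) hα.2 hα'.1 hε₀.2.le hK1 (mesh_pos n) (mesh_le_one n)
    (mesh_pos (m + 1)) hμ
  rw [hvc, hcardR, hT, mesh_add] at htail
  have hfin := le_eight_mul_exp_of_le (γ := γ) (measureReal_le_one (μ := P))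
    (Real.one_le_rpow_of_pos_of_le_one_of_nonpos (mesh_pos n) (mesh_le_one n)
      (by linarith [hα'.2] : 2 * α' - 1 ≤ 0))
    (mul_nonneg (mul_nonneg (Real.rpow_nonneg (by linarith) _)
      (Real.rpow_nonneg (mesh_pos n).le _)) (Real.rpow_nonneg (mesh_pos _).le _)) hγ.2
    (htail.trans (mul_le_mul_of_nonneg_left (Real.exp_le_exp.2 hexp) (by norm_num)))
  rw [hX']
  simp only [B, Set.mem_ofPred_eq, hT, mesh_add n (m + 1)]
  refine hfin.trans (le_of_eq ?_)
  congr 2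
  ring
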